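/- For integers $d_x,d_y\ge 1$, a quadratic min-max problem is $\min_{x\in\mathbb R^{d_x}}\max_{y\in\mathbb R^{d_y}} f(z)$, where $z=(x,y)$ and $$f(z)=\tfrac12 (z-z^*)^\top \begin{bmatrix} A & B\\ B^\top & -C\end{bmatrix}(z-z^*),\qquad A,\ C \text{ symmetric},$$ with solution $z^*$ and saddle operator $F=(\nabla_x f,-\nabla_y f)$. For $0<\mu<L$ and $\kappa=L/\mu$, the problem is called $\kappa$-conditioned (with parameters $\mu,L$) if $f(\cdot,y)$ is $\mu$-strongly convex for every $y$, $f(x,\cdot)$ is $\mu$-strongly concave for every $x$, and $\nabla f$ is $L$-Lipschitz in the Euclidean norm. A non-adaptive symmetric Krylov-subspace algorithm is given by real coefficients $c_{t,k}=c_{t,k}(\mu,L)$, $0\le k<t$, and produces from an initial point $z_0$ the iterates $$z_t=z_0+\sum_{k=0}^{t-1}c_{t,k}F(z_k),\qquad t\ge 1.$$ Let $\Omega=\{\lambda\in\mathbb C:|\lambda|\le 1,\ \mathrm{Re}\,\lambda\ge 0\}$ be the unit half-disc and let $$\Phi_\Omega(\lambda)=\frac{(1-u)-\sqrt3\, i\,(1+u)}{2(u-1)},\qquad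 u=\Big(\frac{\lambda-i}{\lambda+i}\Big)^{2/3}\ \text{(principal branch)},$$ be the conformal map of the exterior of $\Omega$ onto the exterior of the closed unit disc that fixes $\infty$. **Theorem.** For any non-adaptive symmetric Krylov-subspace algorithm, any number of iterations $T\ge 0$, and any $0<\mu<L$ with $\kappa=L/\mu$, there are dimensions $d_x,d_y\ge1$ such that for every initial point $z_0\in\mathbb R^{d_x+d_y}$ there exists a $\kappa$-conditioned quadratic min-max problem with solution $z^*\ne z_0$ for which $$\frac{\|z_T-z^*\|}{\|z_0-z^*\|}\ \ge\ \left|\Phi_\Omega\!\left(\frac{-1}{\kappa-1}\right)\right|^{-T}.$$ Moreover there is a function $\varepsilon:\mathbb R\to\mathbb R$ with $\varepsilon(\kappa)\to0$ as $\kappa\to\infty$ such that, for all $\kappa>1$ and all integers $T\ge0$, $$\left|\Phi_\Omega\!\left(\frac{-1}{\kappa-1}\right)\right|^{-T}=\exp\!\left(-\left(\frac{4}{3\sqrt3}+\varepsilon(\kappa)\right)\frac T\kappa\right).$$ -/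

import Mathlib

open scoped Matrix Gradient Topology

noncomputable section

namespace MinMax

/-- An unconstrained quadratic min-max problem `min_x max_y f(x, y)` on `ℝ^dx × ℝ^dy`, given by
the blocks of its Hessian and by its stationary point `sol = z* = (x*, y*)`. -/
structure QuadraticProblem (dx dy : ℕ) where
  A : Matrix (Fin dx) (Fin dx) ℝ
  B : Matrix (Fin dx) (Fin dy) ℝ
  C : Matrix (Fin dy) (Fin dy) ℝ
  A_symm : A.IsSymm
  C_symm : C.IsSymm
  sol : EuclideanSpace ℝ (Fin dx ⊕ Fin dy)

/-- The concatenation `z = (x, y)`. -/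
def concat {dx dy : ℕ} (x : EuclideanSpace ℝ (Fin dx)) (y : EuclideanSpace ℝ (Fin dy)) :
    EuclideanSpace ℝ (Fin dx ⊕ Fin dy) :=
  WithLp.toLp 2 (Sum.elim x y)

namespace QuadraticProblem

variable {dx dy : ℕ} (P : QuadraticProblem dx dy)

/-- The Hessian `H = [[A, B], [Bᵀ, -C]]`. -/
def hessian : Matrix (Fin dx ⊕ Fin dy) (Fin dx ⊕ Fin dy) ℝ :=
  Matrix.fromBlocks P.A P.B P.Bᵀ (-P.C)

/-- The objective `f(z) = (1/2) (z - z*)ᵀ H (z - z*)`. -/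
def objective (z : EuclideanSpace ℝ (Fin dx ⊕ Fin dy)) : ℝ :=
  (1 / 2 : ℝ) * ((z - P.sol).ofLp ⬝ᵥ (P.hessian *ᵥ (z - P.sol).ofLp))

/-- The saddle operator `F = (∇_x f, -∇_y f) = J ∇f`, where `J = diag(I, -I)`. -/
def saddleOperator (z : EuclideanSpace ℝ (Fin dx ⊕ Fin dy)) :
    EuclideanSpace ℝ (Fin dx ⊕ Fin dy) :=
  WithLp.toLp 2 (Matrix.fromBlocks (1 : Matrix (Fin dx) (Fin dx) ℝ) 0 0
    (-1 : Matrix (Fin dy) (Fin dy) ℝ) *ᵥ (∇ P.objective z).ofLp)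

/-- `f` is `μ`-strongly-convex-strongly-concave. -/
def IsSCSC (μ : ℝ) : Prop :=
  (∀ y, StrongConvexOn Set.univ μ fun x => P.objective (concat x y)) ∧
    ∀ x, StrongConcaveOn Set.univ μ fun y => P.objective (concat x y)

/-- `f` is `L`-smooth: its gradient is `L`-Lipschitz for the Euclidean norm. -/
def IsSmooth (L : ℝ) : Prop :=
  ∀ z z', ‖∇ P.objective z - ∇ P.objective z'‖ ≤ L * ‖z - z'‖

theorem hessian_isSymm : P.hessianᵀ = P.hessian := by
  simp [hessian, Matrix.fromBlocks_transpose, P.A_symm.eq, P.C_symm.eq]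

/-- The objective is differentiable, with gradient `∇f(z) = H (z - z*)`. -/
theorem hasGradientAt_objective (z : EuclideanSpace ℝ (Fin dx ⊕ Fin dy)) :
    HasGradientAt P.objective (WithLp.toLp 2 (P.hessian *ᵥ (z - P.sol).ofLp)) z := by
  have hs : ∀ u v : Fin dx ⊕ Fin dy → ℝ, u ⬝ᵥ (P.hessian *ᵥ v) = v ⬝ᵥ (P.hessian *ᵥ u) := by
    intro u v
    rw [Matrix.dotProduct_mulVec, ← Matrix.mulVec_transpose, P.hessian_isSymm, dotProduct_comm]
  let M : EuclideanSpace ℝ (Fin dx ⊕ Fin dy) →L[ℝ] EuclideanSpace ℝ (Fin dx ⊕ Fin dy) :=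
    Matrix.toEuclideanCLM (𝕜 := ℝ) P.hessian
  have hM : ∀ w, (M w).ofLp = P.hessian *ᵥ w.ofLp := fun w => rfl
  have hi : ∀ v w : EuclideanSpace ℝ (Fin dx ⊕ Fin dy), inner ℝ v w = v.ofLp ⬝ᵥ w.ofLp := by
    intro v w
    rw [EuclideanSpace.inner_eq_star_dotProduct, dotProduct_comm]
    rfl
  have hf : P.objective = fun w => (1 / 2 : ℝ) * inner ℝ (w - P.sol) (M (w - P.sol)) := by
    funext w
    rw [hi, hM]
    rfl
  rw [hasGradientAt_iff_hasFDerivAt, hf]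
  have h1 : HasFDerivAt (fun w : EuclideanSpace ℝ (Fin dx ⊕ Fin dy) => w - P.sol)
      (ContinuousLinearMap.id ℝ _) z := (hasFDerivAt_id z).sub_const _
  have h2 := (h1.inner ℝ (M.hasFDerivAt.comp z h1)).const_mul (1 / 2 : ℝ)
  refine h2.congr_fderiv ?_
  ext v
  simp [hi, hM]
  rw [dotProduct_comm (P.hessian *ᵥ _), Matrix.mulVec_sub, dotProduct_sub, hs v.ofLp z.ofLp,
    hs v.ofLp P.sol.ofLp]
  ring

end QuadraticProblem

/-- A non-adaptive symmetric Krylov-subspace algorithm: the coefficients `c_{t,k}` are functions of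
`μ`, `L`, `t`, `k` only (in this order; only those with `k < t` are used). -/
structure NonadaptiveSymmetricAlgorithm where
  coeff : ℝ → ℝ → ℕ → ℕ → ℝ

/-- The iterates `z_t = z_0 + ∑_{k < t} c_{t,k} F(z_k)` of the algorithm for the parameters `μ`, `L`,
run with the operator `F` from the initial point `z_0`. -/
def NonadaptiveSymmetricAlgorithm.iterate (alg : NonadaptiveSymmetricAlgorithm) (μ L : ℝ)
    {E : Type*} [AddCommGroup E] [Module ℝ E] (F : E → E) (z₀ : E) (t : ℕ) : E :=
  z₀ + ∑ k : Fin t, alg.coeff μ L t k • F (alg.iterate μ L F z₀ k)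
termination_by t
decreasing_by exact k.2

/-- The conformal map from the exterior of the unit half-disc
`Ω = {z : |z| ≤ 1, Re z ≥ 0}` to the exterior of the unit disc. For `λ ∉ Ω` the number
`(λ - i) / (λ + i)` lies off the closed third quadrant, so that the principal branch of the power,
which Mathlib uses, is the holomorphic one there, with value `1` at `λ = ∞`. -/
def halfDiscMap (l : ℂ) : ℂ :=
  let u : ℂ := ((l - Complex.I) / (l + Complex.I)) ^ (2 / 3 : ℂ)
  ((1 - u) - (Real.sqrt 3 : ℂ) * Complex.I * (1 + u)) / (2 * (u - 1))

end MinMax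

end

/-! With one-dimensional `x` and `y`, identify the plane with `ℂ`. The saddle operator of
`rotationProblem` is multiplication by `l` around `z*`, so the error after `T` steps is the initial
error times `p(l)`. Here `p` is a polynomial of degree at most `T` with `p(0) = 1` that depends only
on the algorithm, `μ` and `L`. Every `l ∈ μ + (L - μ)Ω` gives an admissible problem, so it remains
to bound the maximum of `|p|` on this set from below.

This is the Bernstein-Walsh inequality (`exists_mem_halfDisc_le_norm_eval`). Let `ψ = sheetSum /
sheetDiff`, found by solving `Φ(λ) = 1/ζ` for `λ`: with `D, N = 1 + e^{±iπ/3} ζ` one gets `u = N/D`.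
Its pole at `0` is simple, so `ζ^T q(ψ(ζ))` is holomorphic in the unit disc for `deg q ≤ T`. The
maximum principle passes to the circle, which `ψ` sends into `Ω` (`sheetSum_div_sheetDiff_mem`). In
the normalised variable, `0` becomes `-1/(κ-1)`, where `ψ` and `Φ` are explicit
(`sheetSum_div_sheetDiff_axisRatio`, `halfDiscMap_neg`). The exponential rate is a derivative of
this closed form at `0`. -/

noncomputable section

namespace MinMax

open Polynomial

/-! ### Planar problems as complex multiplication -/

/-- The identification of `ℂ` with `ℝ¹ × ℝ¹`. -/
def complexToPair : ℂ →ₗ[ℝ] EuclideanSpace ℝ (Fin 1 ⊕ Fin 1) where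
  toFun c := WithLp.toLp 2 (Sum.elim (fun _ => c.re) (fun _ => c.im))
  map_add' c d := by
    ext i
    rcases i with i | i <;> simp
  map_smul' r c := by
    ext i
    rcases i with i | i <;> simp

theorem norm_complexToPair (c : ℂ) : ‖complexToPair c‖ = ‖c‖ := by
  rw [EuclideanSpace.norm_eq, Complex.norm_eq_sqrt_sq_add_sq]
  simp [complexToPair]

theorem exists_complexToPair_eq (z : EuclideanSpace ℝ (Fin 1 ⊕ Fin 1)) :
    ∃ c, complexToPair c = z := by
  refine ⟨⟨z (Sum.inl 0), z (Sum.inr 0)⟩, ?_⟩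
  ext i
  rcases i with i | i <;> simp [complexToPair, Subsingleton.elim i 0]

/-- The problem with one-dimensional `x`, `y` whose saddle operator is multiplication by `l`. -/
def rotationProblem (l : ℂ) (s : EuclideanSpace ℝ (Fin 1 ⊕ Fin 1)) : QuadraticProblem 1 1 where
  A := !![l.re]
  B := !![-l.im]
  C := !![l.re]
  A_symm := by ext i j; simp [Subsingleton.elim i j]
  C_symm := by ext i j; simp [Subsingleton.elim i j]
  sol := s

theorem gradient_rotationProblem (l : ℂ) (s : EuclideanSpace ℝ (Fin 1 ⊕ Fin 1)) (c : ℂ) :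
    ∇ (rotationProblem l s).objective (complexToPair c + s) =
      complexToPair (starRingEnd ℂ (l * c)) := by
  rw [((rotationProblem l s).hasGradientAt_objective _).gradient]
  ext i
  rcases i with i | i <;>
    simp [rotationProblem, QuadraticProblem.hessian, complexToPair, Matrix.mulVec, dotProduct] <;>
    ring

/-- The gradient is the conjugate of `l * c`, and the sign change in `y` undoes the conjugation. -/
theorem saddleOperator_rotationProblem (l : ℂ) (s : EuclideanSpace ℝ (Fin 1 ⊕ Fin 1)) (c : ℂ) :
    (rotationProblem l s).saddleOperator (complexToPair c + s) = complexToPair (l * c) := by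
  rw [QuadraticProblem.saddleOperator, gradient_rotationProblem]
  ext i
  rcases i with i | i <;>
    simp [complexToPair, Matrix.mulVec, dotProduct, Matrix.one_apply, Subsingleton.elim i 0,
      add_comm]

theorem objective_rotationProblem (l : ℂ) (s : EuclideanSpace ℝ (Fin 1 ⊕ Fin 1))
    (x y : EuclideanSpace ℝ (Fin 1)) :
    (rotationProblem l s).objective (concat x y) =
      1 / 2 * (l.re * (x 0 - s (Sum.inl 0)) ^ 2
        - 2 * l.im * (x 0 - s (Sum.inl 0)) * (y 0 - s (Sum.inr 0))
        - l.re * (y 0 - s (Sum.inr 0)) ^ 2) := by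
  simp [QuadraticProblem.objective, rotationProblem, QuadraticProblem.hessian, concat,
    Matrix.mulVec, dotProduct]
  ring

theorem isSCSC_rotationProblem {l : ℂ} (s : EuclideanSpace ℝ (Fin 1 ⊕ Fin 1)) {μ : ℝ}
    (h : μ ≤ l.re) : (rotationProblem l s).IsSCSC μ := by
  have hn : ∀ x y : EuclideanSpace ℝ (Fin 1), ‖x - y‖ ^ 2 = (x 0 - y 0) ^ 2 := by
    intro x y
    rw [EuclideanSpace.norm_sq_eq]
    simp
  refine ⟨fun y => ⟨convex_univ, fun x _ x' _ a b ha hb hab => ?_⟩,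
    fun x => ⟨convex_univ, fun y _ y' _ a b ha hb hab => ?_⟩⟩ <;>
  · simp only [objective_rotationProblem, hn, PiLp.add_apply, PiLp.smul_apply, smul_eq_mul]
    obtain rfl : b = 1 - a := by linarith
    first
    | nlinarith [mul_nonneg (mul_nonneg ha hb)
        (mul_nonneg (sub_nonneg.2 h) (sq_nonneg (x 0 - x' 0)))]
    | nlinarith [mul_nonneg (mul_nonneg ha hb)
        (mul_nonneg (sub_nonneg.2 h) (sq_nonneg (y 0 - y' 0)))]

theorem isSmooth_rotationProblem {l : ℂ} (s : EuclideanSpace ℝ (Fin 1 ⊕ Fin 1)) {L : ℝ}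
    (h : ‖l‖ ≤ L) : (rotationProblem l s).IsSmooth L := by
  intro z z'
  obtain ⟨c, hc⟩ := exists_complexToPair_eq (z - s)
  obtain ⟨c', hc'⟩ := exists_complexToPair_eq (z' - s)
  obtain rfl : z = complexToPair c + s := by rw [hc]; abel
  obtain rfl : z' = complexToPair c' + s := by rw [hc']; abel
  rw [gradient_rotationProblem, gradient_rotationProblem, add_sub_add_right_eq_sub, ← map_sub,
    ← map_sub, ← map_sub, norm_complexToPair, norm_complexToPair, Complex.norm_conj, ← mul_sub,
    norm_mul]
  gcongr

/-! ### Residual polynomials -/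

/-- The polynomial `p` with `z_t - z* = p(M) (z_0 - z*)` when `F(z) = M (z - z*)`. -/
def NonadaptiveSymmetricAlgorithm.residual (alg : NonadaptiveSymmetricAlgorithm) (μ L : ℝ)
    (t : ℕ) : ℂ[X] :=
  1 + ∑ k : Fin t, C (alg.coeff μ L t k : ℂ) * (X * alg.residual μ L k)
termination_by t
decreasing_by exact k.2

theorem NonadaptiveSymmetricAlgorithm.eval_residual_zero (alg : NonadaptiveSymmetricAlgorithm)
    (μ L : ℝ) (t : ℕ) : (alg.residual μ L t).eval 0 = 1 := by
  rw [residual]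
  simp [eval_finsetSum]

theorem NonadaptiveSymmetricAlgorithm.natDegree_residual_le (alg : NonadaptiveSymmetricAlgorithm)
    (μ L : ℝ) (t : ℕ) : (alg.residual μ L t).natDegree ≤ t := by
  induction t using Nat.strong_induction_on with
  | _ t ih =>
    rw [residual]
    refine natDegree_add_le_of_degree_le (by simp) (natDegree_sum_le_of_forall_le _ _ ?_)
    intro k _
    refine (natDegree_C_mul_le _ _).trans (natDegree_mul_le.trans ?_)
    have := ih k k.2
    have := k.2
    have := natDegree_X_le (R := ℂ)
    omega

theorem iterate_rotationProblem (alg : NonadaptiveSymmetricAlgorithm) (μ L : ℝ) (l : ℂ)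
    (s : EuclideanSpace ℝ (Fin 1 ⊕ Fin 1)) (c : ℂ) (t : ℕ) :
    alg.iterate μ L (rotationProblem l s).saddleOperator (complexToPair c + s) t =
      complexToPair ((alg.residual μ L t).eval l * c) + s := by
  induction t using Nat.strong_induction_on with
  | _ t ih =>
    rw [NonadaptiveSymmetricAlgorithm.iterate, NonadaptiveSymmetricAlgorithm.residual]
    have : ∀ k : Fin t, alg.coeff μ L t k • (rotationProblem l s).saddleOperator
        (alg.iterate μ L (rotationProblem l s).saddleOperator (complexToPair c + s) k) =
        complexToPair ((alg.coeff μ L t k : ℂ) * (l * (alg.residual μ L k).eval l) * c) := by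
      intro k
      rw [ih k k.2, saddleOperator_rotationProblem, ← map_smul, Complex.real_smul]
      ring_nf
    simp_rw [this]
    rw [← map_sum]
    simp only [eval_add, eval_one, eval_finsetSum, eval_mul, eval_C, eval_X, add_mul, one_mul,
      Finset.sum_mul, map_add]
    abel

/-! ### The power `3/2` on the closed disc -/

/-- The function `ζ ↦ (1 + e^{iθ} ζ)^{3/2}`. -/
def shiftedPow (θ : ℝ) (ζ : ℂ) : ℂ :=
  (1 + Complex.exp (θ * Complex.I) * ζ) ^ (3 / 2 : ℂ)

theorem mul_exp_cpow {r θ : ℝ} (hr : 0 ≤ r) (h1 : -Real.pi < θ) (h2 : θ ≤ Real.pi) :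
    (r * Complex.exp (θ * Complex.I)) ^ (3 / 2 : ℂ) =
      ((r ^ (3 / 2 : ℝ) : ℝ) : ℂ) * Complex.exp ((3 / 2 * θ : ℝ) * Complex.I) := by
  rcases hr.eq_or_lt with rfl | hr
  · simp [Real.zero_rpow]
  have hl : Complex.log (r * Complex.exp (θ * Complex.I)) = Real.log r + θ * Complex.I := by
    rw [Complex.log_ofReal_mul hr (Complex.exp_ne_zero _), Complex.log_exp] <;> simpa
  rw [Complex.cpow_def_of_ne_zero (by simp [hr.ne']), hl, Real.rpow_def_of_pos hr,
    Complex.ofReal_exp, ← Complex.exp_add]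
  congr 1
  push_cast
  ring

theorem one_add_exp (φ : ℝ) : 1 + Complex.exp (φ * Complex.I) =
    ((2 * Real.cos (φ / 2) : ℝ) : ℂ) * Complex.exp ((φ / 2 : ℝ) * Complex.I) := by
  push_cast
  rw [Complex.cos, mul_div_cancel₀ _ two_ne_zero, add_mul, ← Complex.exp_add, ← Complex.exp_add]
  rw [show (φ / 2 * Complex.I + φ / 2 * Complex.I : ℂ) = φ * Complex.I by ring,
    show (-(φ / 2) * Complex.I + φ / 2 * Complex.I : ℂ) = 0 by ring, Complex.exp_zero]
  ring

theorem one_add_exp_cpow {φ : ℝ} (h1 : -Real.pi < φ) (h2 : φ ≤ Real.pi) :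
    (1 + Complex.exp (φ * Complex.I)) ^ (3 / 2 : ℂ) =
      (((2 * Real.cos (φ / 2)) ^ (3 / 2 : ℝ) : ℝ) : ℂ) *
        Complex.exp ((3 / 4 * φ : ℝ) * Complex.I) := by
  have hc : 0 ≤ Real.cos (φ / 2) := Real.cos_nonneg_of_mem_Icc ⟨by linarith, by linarith⟩
  have hp := Real.pi_pos
  rw [one_add_exp, mul_exp_cpow (by positivity) (by linarith) (by linarith)]
  congr 4
  ring

theorem re_one_add_nonneg {ζ : ℂ} (hζ : ‖ζ‖ ≤ 1) (θ : ℝ) :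
    0 ≤ (1 + Complex.exp (θ * Complex.I) * ζ).re := by
  have h : ‖Complex.exp (θ * Complex.I) * ζ‖ ≤ 1 := by
    rwa [norm_mul, Complex.norm_exp_ofReal_mul_I, one_mul]
  have := (abs_le.1 ((Complex.abs_re_le_norm _).trans h)).1
  rw [Complex.add_re, Complex.one_re]
  linarith

theorem re_one_add_pos {ζ : ℂ} (hζ : ‖ζ‖ < 1) (θ : ℝ) :
    0 < (1 + Complex.exp (θ * Complex.I) * ζ).re := by
  have h : ‖Complex.exp (θ * Complex.I) * ζ‖ < 1 := by
    rwa [norm_mul, Complex.norm_exp_ofReal_mul_I, one_mul]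
  have := (abs_lt.1 ((Complex.abs_re_le_norm _).trans_lt h)).1
  rw [Complex.add_re, Complex.one_re]
  linarith

theorem hasDerivAt_shiftedPow (θ : ℝ) {ζ : ℂ} (hζ : ‖ζ‖ < 1) :
    HasDerivAt (shiftedPow θ) (3 / 2 * (1 + Complex.exp (θ * Complex.I) * ζ) ^ (3 / 2 - 1 : ℂ) *
      Complex.exp (θ * Complex.I)) ζ := by
  have h : HasDerivAt (fun ζ : ℂ => 1 + Complex.exp (θ * Complex.I) * ζ)
      (Complex.exp (θ * Complex.I)) ζ := by
    simpa using ((hasDerivAt_id ζ).const_mul (Complex.exp (θ * Complex.I))).const_add 1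
  exact h.cpow_const (Or.inl (re_one_add_pos hζ θ))

/-- The base stays in the closed right half-plane, so the only delicate point is its zero on the
circle; there continuity holds because the exponent has positive real part. -/
theorem continuousOn_shiftedPow (θ : ℝ) :
    ContinuousOn (shiftedPow θ) (Metric.closedBall 0 1) := by
  intro ζ hζ
  have h : ContinuousAt (fun ζ : ℂ => 1 + Complex.exp (θ * Complex.I) * ζ) ζ := by fun_prop
  have h' : ContinuousAt (fun x : ℂ => x ^ (3 / 2 : ℂ)) (1 + Complex.exp (θ * Complex.I) * ζ) :=
    Complex.continuousAt_cpow_const_of_re_pos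
      (Or.inl (re_one_add_nonneg (by simpa using hζ) θ)) (by norm_num)
  exact (h'.comp_of_eq h rfl).continuousWithinAt

theorem diffContOnCl_shiftedPow (θ : ℝ) : DiffContOnCl ℂ (shiftedPow θ) (Metric.ball 0 1) :=
  .mk_ball (fun _ hζ => (hasDerivAt_shiftedPow θ
    (by simpa using hζ)).differentiableAt.differentiableWithinAt) (continuousOn_shiftedPow θ)

/-- The power `3/2` is injective on the closed right half-plane. -/
theorem cpow_three_halves_injOn {a b : ℂ} (ha : 0 ≤ a.re) (hb : 0 ≤ b.re)
    (h : a ^ (3 / 2 : ℂ) = b ^ (3 / 2 : ℂ)) : a = b := by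
  rcases eq_or_ne a 0 with rfl | ha0
  · rw [Complex.zero_cpow (by norm_num), eq_comm, Complex.cpow_eq_zero_iff] at h
    exact h.1.symm
  rcases eq_or_ne b 0 with rfl | hb0
  · rw [Complex.zero_cpow (by norm_num), Complex.cpow_eq_zero_iff] at h
    exact h.1
  rw [Complex.cpow_def_of_ne_zero ha0, Complex.cpow_def_of_ne_zero hb0,
    Complex.exp_eq_exp_iff_exists_int] at h
  obtain ⟨n, hn⟩ := h
  have him := congrArg Complex.im hn
  have e1 := abs_le.1 (Complex.abs_arg_le_pi_div_two_iff.2 ha)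
  have e2 := abs_le.1 (Complex.abs_arg_le_pi_div_two_iff.2 hb)
  have hp := Real.pi_pos
  have him' : a.arg * (3 / 2) = b.arg * (3 / 2) + n * (2 * Real.pi) := by
    simpa [Complex.mul_im, Complex.log_im] using him
  -- Both arguments lie in `[-π/2, π/2]`, so `3/2` times their difference is at most `3π/2 < 2π` in
  -- absolute value.
  have hn0 : n = 0 := by
    have h1 : (n : ℝ) < 1 := by nlinarith
    have h2 : (-1 : ℝ) < n := by nlinarith
    have h1' : n < 1 := by exact_mod_cast h1
    have h2' : -1 < n := by exact_mod_cast h2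
    omega
  have hl : Complex.log a = Complex.log b := by
    rw [hn0] at hn
    simpa using hn
  rw [← Complex.exp_log ha0, hl, Complex.exp_log hb0]

/-! ### The inverse conformal map and its boundary values -/

/-- The denominator of the inverse of the conformal map of the exterior of the half-disc. -/
def sheetDiff (ζ : ℂ) : ℂ :=
  shiftedPow (Real.pi / 3) ζ - shiftedPow (-(Real.pi / 3)) ζ

/-- The numerator of the inverse of the conformal map of the exterior of the half-disc. -/
def sheetSum (ζ : ℂ) : ℂ :=
  Complex.I * (shiftedPow (Real.pi / 3) ζ + shiftedPow (-(Real.pi / 3)) ζ)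

theorem exp_sub_exp_pi_div_three : Complex.exp ((Real.pi / 3 : ℝ) * Complex.I) -
    Complex.exp ((-(Real.pi / 3) : ℝ) * Complex.I) ≠ 0 := by
  intro h
  have := congrArg Complex.im h
  rw [Complex.sub_im, Complex.exp_ofReal_mul_I_im, Complex.exp_ofReal_mul_I_im, Real.sin_neg,
    Real.sin_pi_div_three] at this
  have h3 : 0 < Real.sqrt 3 := by positivity
  simp at this

theorem sheetDiff_zero : sheetDiff 0 = 0 := by
  simp [sheetDiff, shiftedPow]

theorem sheetDiff_ne_zero {ζ : ℂ} (hζ : ‖ζ‖ ≤ 1) (h0 : ζ ≠ 0) : sheetDiff ζ ≠ 0 := by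
  intro h
  have := cpow_three_halves_injOn (re_one_add_nonneg hζ _) (re_one_add_nonneg hζ _)
    (sub_eq_zero.1 h)
  have := mul_right_cancel₀ h0 (add_left_cancel this)
  exact exp_sub_exp_pi_div_three (sub_eq_zero.2 this)

/-- The zero of `sheetDiff` at the origin is simple and is its only zero in the closed disc, so
dividing it out leaves an invertible function. -/
theorem dslope_sheetDiff_ne_zero {ζ : ℂ} (hζ : ‖ζ‖ ≤ 1) : dslope sheetDiff 0 ζ ≠ 0 := by
  rcases eq_or_ne ζ 0 with rfl | h0
  · rw [dslope_same]
    have h : HasDerivAt sheetDiff _ 0 := (hasDerivAt_shiftedPow (Real.pi / 3) (by simp)).sub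
      (hasDerivAt_shiftedPow (-(Real.pi / 3)) (by simp))
    rw [h.deriv]
    simp only [mul_zero, add_zero, Complex.one_cpow, mul_one, ← mul_sub]
    exact mul_ne_zero (by norm_num) exp_sub_exp_pi_div_three
  · rw [dslope_of_ne _ h0, slope_def_field, sheetDiff_zero, sub_zero, sub_zero]
    exact div_ne_zero (sheetDiff_ne_zero hζ h0) h0

theorem diffContOnCl_sheetDiff : DiffContOnCl ℂ sheetDiff (Metric.ball 0 1) :=
  (diffContOnCl_shiftedPow _).sub (diffContOnCl_shiftedPow _)

theorem diffContOnCl_dslope_sheetDiff :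
    DiffContOnCl ℂ (dslope sheetDiff 0) (Metric.ball 0 1) := by
  have hb : Metric.ball (0 : ℂ) 1 ∈ 𝓝 0 := Metric.ball_mem_nhds _ one_pos
  refine .mk_ball ((Complex.differentiableOn_dslope hb).2 diffContOnCl_sheetDiff.1) ?_
  exact (continuousOn_dslope (Metric.closedBall_mem_nhds _ one_pos)).2
    ⟨diffContOnCl_sheetDiff.continuousOn_ball, diffContOnCl_sheetDiff.1.differentiableAt hb⟩

/-- The inverse of the conformal map times the variable: holomorphic in the open disc. -/
def invMapMul (ζ : ℂ) : ℂ :=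
  sheetSum ζ * (dslope sheetDiff 0 ζ)⁻¹

theorem diffContOnCl_invMapMul : DiffContOnCl ℂ invMapMul (Metric.ball 0 1) := by
  have h1 : DiffContOnCl ℂ sheetSum (Metric.ball 0 1) :=
    (((diffContOnCl_shiftedPow _).add (diffContOnCl_shiftedPow _)).const_smul Complex.I)
  refine h1.smul (diffContOnCl_dslope_sheetDiff.inv fun ζ hζ => ?_)
  rw [closure_ball _ one_ne_zero] at hζ
  exact dslope_sheetDiff_ne_zero (by simpa using hζ)

theorem invMapMul_eq {ζ : ℂ} (h0 : ζ ≠ 0) : invMapMul ζ = sheetSum ζ / sheetDiff ζ * ζ := by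
  rw [invMapMul, dslope_of_ne _ h0, slope_def_field, sheetDiff_zero, sub_zero, sub_zero, inv_div]
  ring

/-- A quotient of conjugates is unimodular. When `s = n = 0` the quotient is `0`, still in the
half-disc, so no nonvanishing is needed. -/
theorem div_mem_halfDisc_arc {s n : ℝ} (hs : 0 ≤ s) (hn : 0 ≤ n) :
    ‖(s - n * Complex.I) / (s + n * Complex.I) * Complex.I‖ ≤ 1 ∧
      0 ≤ ((s - n * Complex.I) / (s + n * Complex.I) * Complex.I).re := by
  constructor
  · have : ‖(s - n * Complex.I : ℂ)‖ = ‖(s + n * Complex.I : ℂ)‖ := by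
      rw [← Complex.norm_conj]
      simp [sub_eq_add_neg]
    rw [norm_mul, norm_div, this, Complex.norm_I, mul_one]
    exact div_self_le_one _
  · rw [Complex.mul_I_re, Complex.div_im]
    simp only [Complex.sub_im, Complex.sub_re, Complex.add_im, Complex.add_re, Complex.ofReal_re,
      Complex.ofReal_im, Complex.mul_re, Complex.mul_im, Complex.I_re, Complex.I_im]
    ring_nf
    have := Complex.normSq_nonneg (s + n * Complex.I)
    positivity

theorem div_mem_halfDisc_diameter {s n : ℝ} (hs : 0 ≤ s) (hn : 0 ≤ n) :
    ‖((s - n : ℝ) / (s + n : ℝ) : ℂ) * Complex.I‖ ≤ 1 ∧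
      0 ≤ (((s - n : ℝ) / (s + n : ℝ) : ℂ) * Complex.I).re := by
  constructor
  · rw [← Complex.ofReal_div, norm_mul, Complex.norm_real, Complex.norm_I, mul_one,
      Real.norm_eq_abs, abs_div]
    refine div_le_one_of_le₀ ?_ (abs_nonneg _)
    rw [abs_of_nonneg (add_nonneg hs hn)]
    exact abs_le.2 ⟨by linarith, by linarith⟩
  · rw [← Complex.ofReal_div, Complex.mul_I_re, Complex.ofReal_im, neg_zero]

/-- The inverse map sends the unit circle into the half-disc. -/
theorem sheetSum_div_sheetDiff_mem {ζ : ℂ} (hζ : ‖ζ‖ = 1) :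
    ‖sheetSum ζ / sheetDiff ζ‖ ≤ 1 ∧ 0 ≤ (sheetSum ζ / sheetDiff ζ).re := by
  have hp := Real.pi_pos
  set η := Complex.exp ((-(Real.pi / 3) : ℝ) * Complex.I) * ζ with hη
  have hη1 : ‖η‖ = 1 := by rw [hη, norm_mul, Complex.norm_exp_ofReal_mul_I, hζ, one_mul]
  set φ := η.arg with hφ
  have hηe : η = Complex.exp (φ * Complex.I) := by
    have := Complex.norm_mul_exp_arg_mul_I η
    rw [hη1, Complex.ofReal_one, one_mul] at this
    exact this.symm
  have h1 : -Real.pi < φ := Complex.neg_pi_lt_arg _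
  have h2 : φ ≤ Real.pi := Complex.arg_le_pi _
  have hN : shiftedPow (-(Real.pi / 3)) ζ = (((2 * Real.cos (φ / 2)) ^ (3 / 2 : ℝ) : ℝ) : ℂ) *
      Complex.exp ((3 / 4 * φ : ℝ) * Complex.I) := by
    rw [shiftedPow, ← hη, hηe, one_add_exp_cpow h1 h2]
  have hηD : Complex.exp ((Real.pi / 3 : ℝ) * Complex.I) * ζ =
      Complex.exp ((φ + 2 * Real.pi / 3 : ℝ) * Complex.I) := by
    have : ζ = Complex.exp ((Real.pi / 3 : ℝ) * Complex.I) * η := by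
      rw [hη, ← mul_assoc, ← Complex.exp_add]
      simp
    rw [this, hηe, ← mul_assoc, ← Complex.exp_add, ← Complex.exp_add]
    congr 1
    push_cast
    ring
  have hn : 0 ≤ (2 * Real.cos (φ / 2)) ^ (3 / 2 : ℝ) := Real.rpow_nonneg (mul_nonneg zero_le_two
    (Real.cos_nonneg_of_mem_Icc ⟨by linarith, by linarith⟩)) _
  set n := (2 * Real.cos (φ / 2)) ^ (3 / 2 : ℝ)
  -- The unit numbers added to `1` have arguments `φ` and `φ + 2π/3`. Without wrapping past `π`, the
  -- `3/2` powers differ in phase by `3/4 · 2π/3 = π/2`, which gives the arc.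
  rcases le_or_gt (φ + 2 * Real.pi / 3) Real.pi with h | h
  · have hD := one_add_exp_cpow (φ := φ + 2 * Real.pi / 3) (by linarith) h
    have hs : 0 ≤ (2 * Real.cos ((φ + 2 * Real.pi / 3) / 2)) ^ (3 / 2 : ℝ) :=
      Real.rpow_nonneg (mul_nonneg zero_le_two
        (Real.cos_nonneg_of_mem_Icc ⟨by linarith, by linarith⟩)) _
    set s := (2 * Real.cos ((φ + 2 * Real.pi / 3) / 2)) ^ (3 / 2 : ℝ)
    have he : Complex.exp ((3 / 4 * (φ + 2 * Real.pi / 3) : ℝ) * Complex.I) =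
        Complex.exp ((3 / 4 * φ : ℝ) * Complex.I) * Complex.I := by
      have hI : Complex.exp ((Real.pi / 2 : ℝ) * Complex.I) = Complex.I := by
        push_cast
        exact Complex.exp_pi_div_two_mul_I
      refine Eq.trans ?_ (congrArg (Complex.exp ((3 / 4 * φ : ℝ) * Complex.I) * ·) hI)
      rw [← Complex.exp_add]
      congr 1
      push_cast
      ring
    have hq : sheetSum ζ / sheetDiff ζ =
        (s - n * Complex.I) / (s + n * Complex.I) * Complex.I := by
      rw [sheetSum, sheetDiff, hN, shiftedPow, hηD, hD, he]
      set E := Complex.exp ((3 / 4 * φ : ℝ) * Complex.I) with hE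
      have hE0 : E ≠ 0 := Complex.exp_ne_zero _
      have h3 : Complex.I * (s * (E * Complex.I) + n * E) =
          E * Complex.I * ((s - n * Complex.I) * Complex.I) := by
        linear_combination ((n : ℂ) * E * Complex.I) * Complex.I_sq
      have h4 : s * (E * Complex.I) - n * E = E * Complex.I * (s + n * Complex.I) := by
        linear_combination (-(n : ℂ) * E) * Complex.I_sq
      rw [h3, h4, mul_div_mul_left _ _ (mul_ne_zero hE0 Complex.I_ne_zero)]
      ring
    rw [hq]
    exact div_mem_halfDisc_arc hs hn
  -- After wrapping, the phase difference is `π/2 - 3π/2 = -π`: both powers are real multiples of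
  -- one number, which gives the diameter.
  · have hD := one_add_exp_cpow (φ := φ + 2 * Real.pi / 3 - 2 * Real.pi) (by linarith)
      (by linarith)
    have hs : 0 ≤ (2 * Real.cos ((φ + 2 * Real.pi / 3 - 2 * Real.pi) / 2)) ^ (3 / 2 : ℝ) :=
      Real.rpow_nonneg (mul_nonneg zero_le_two
        (Real.cos_nonneg_of_mem_Icc ⟨by linarith, by linarith⟩)) _
    set s := (2 * Real.cos ((φ + 2 * Real.pi / 3 - 2 * Real.pi) / 2)) ^ (3 / 2 : ℝ)
    have hηD' : Complex.exp ((φ + 2 * Real.pi / 3 : ℝ) * Complex.I) =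
        Complex.exp ((φ + 2 * Real.pi / 3 - 2 * Real.pi : ℝ) * Complex.I) := by
      rw [← Complex.exp_periodic ((φ + 2 * Real.pi / 3 - 2 * Real.pi : ℝ) * Complex.I)]
      congr 1
      push_cast
      ring
    have he : Complex.exp ((3 / 4 * (φ + 2 * Real.pi / 3 - 2 * Real.pi) : ℝ) * Complex.I) =
        -Complex.exp ((3 / 4 * φ : ℝ) * Complex.I) := by
      rw [← Complex.exp_sub_pi_mul_I]
      congr 1
      push_cast
      ring
    have hq : sheetSum ζ / sheetDiff ζ = ((s - n : ℝ) / (s + n : ℝ) : ℂ) * Complex.I := by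
      rw [sheetSum, sheetDiff, hN, shiftedPow, hηD, hηD', hD, he]
      rw [show Complex.I * (s * -Complex.exp ((3 / 4 * φ : ℝ) * Complex.I) +
          n * Complex.exp ((3 / 4 * φ : ℝ) * Complex.I)) =
          -Complex.exp ((3 / 4 * φ : ℝ) * Complex.I) * ((s - n : ℝ) * Complex.I) by
            push_cast; ring,
        show s * -Complex.exp ((3 / 4 * φ : ℝ) * Complex.I) -
          n * Complex.exp ((3 / 4 * φ : ℝ) * Complex.I) =
          -Complex.exp ((3 / 4 * φ : ℝ) * Complex.I) * (s + n : ℝ) by push_cast; ring,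
        mul_div_mul_left _ _ (neg_ne_zero.2 (Complex.exp_ne_zero _))]
      ring
    rw [hq]
    exact div_mem_halfDisc_diameter hs hn

/-! ### Maximum principle -/

/-- The Bernstein-Walsh inequality for the half-disc, in terms of the inverse conformal map. -/
theorem exists_mem_halfDisc_le_norm_eval (q : ℂ[X]) {T : ℕ} (hq : q.natDegree ≤ T) {ζ : ℂ}
    (h0 : ζ ≠ 0) (h1 : ‖ζ‖ < 1) :
    ∃ l : ℂ, ‖l‖ ≤ 1 ∧ 0 ≤ l.re ∧
      ‖ζ‖ ^ T * ‖q.eval (sheetSum ζ / sheetDiff ζ)‖ ≤ ‖q.eval l‖ := by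
  -- This is `ξ^T q(ψ(ξ))` with the pole cancelled term by term, hence also defined at `0`.
  set h : ℂ → ℂ := fun ξ => ∑ j ∈ Finset.range (T + 1), q.coeff j * (invMapMul ξ ^ j * ξ ^ (T - j))
    with hdef
  have hh : ∀ ξ : ℂ, ξ ≠ 0 → h ξ = ξ ^ T * q.eval (sheetSum ξ / sheetDiff ξ) := by
    intro ξ hξ
    rw [q.eval_eq_sum_range' (Nat.lt_succ_of_le hq), Finset.mul_sum]
    refine Finset.sum_congr rfl fun j hj => ?_
    rw [invMapMul_eq hξ, mul_pow, mul_assoc, ← pow_add,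
      Nat.add_sub_of_le (Finset.mem_range_succ_iff.1 hj)]
    ring
  have hd : DiffContOnCl ℂ h (Metric.ball 0 1) := by
    refine .mk_ball ?_ ?_
    · have := diffContOnCl_invMapMul.1
      fun_prop
    · have := diffContOnCl_invMapMul.continuousOn_ball
      fun_prop
  obtain ⟨ξ, hξ, hmax⟩ := Complex.exists_mem_frontier_isMaxOn_norm Metric.isBounded_ball
    ⟨0, Metric.mem_ball_self one_pos⟩ hd
  rw [frontier_ball _ one_ne_zero, mem_sphere_zero_iff_norm] at hξ
  have hξ0 : ξ ≠ 0 := by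
    rintro rfl
    simp at hξ
  refine ⟨_, (sheetSum_div_sheetDiff_mem hξ).1, (sheetSum_div_sheetDiff_mem hξ).2, ?_⟩
  have := hmax (subset_closure (show ζ ∈ Metric.ball (0 : ℂ) 1 by simpa using h1))
  simpa [hh ζ h0, hh ξ hξ0, hξ] using this

/-! ### Closed form on the negative real axis -/

/-- The half-angle parameter of the point `-t` of the negative real axis. -/
def axisAngle (t : ℝ) : ℝ :=
  (Real.pi - 2 * Real.arctan t) / 3

/-- The ratio `1 / |Φ(-t)|` in closed form. -/
def axisRatio (t : ℝ) : ℝ :=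
  Real.sin (axisAngle t) / Real.sin (axisAngle t + Real.pi / 3)

theorem axisAngle_pos (t : ℝ) : 0 < axisAngle t := by
  have := Real.arctan_lt_pi_div_two t
  rw [axisAngle]
  linarith

theorem axisAngle_lt {t : ℝ} (ht : 0 < t) : axisAngle t < Real.pi / 3 := by
  have := Real.arctan_pos.2 ht
  rw [axisAngle]
  linarith

theorem sin_axisAngle_pos {t : ℝ} (ht : 0 < t) : 0 < Real.sin (axisAngle t) :=
  Real.sin_pos_of_pos_of_lt_pi (axisAngle_pos t)
    (by linarith [axisAngle_lt ht, Real.pi_pos])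

theorem sin_axisAngle_add_pos {t : ℝ} (ht : 0 < t) :
    0 < Real.sin (axisAngle t + Real.pi / 3) :=
  Real.sin_pos_of_pos_of_lt_pi (by linarith [axisAngle_pos t, Real.pi_pos])
    (by linarith [axisAngle_lt ht, Real.pi_pos])

theorem axisRatio_pos {t : ℝ} (ht : 0 < t) : 0 < axisRatio t :=
  div_pos (sin_axisAngle_pos ht) (sin_axisAngle_add_pos ht)

theorem axisRatio_lt_one {t : ℝ} (ht : 0 < t) : axisRatio t < 1 := by
  rw [axisRatio, div_lt_one (sin_axisAngle_add_pos ht), ← sub_pos, Real.sin_sub_sin,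
    show (axisAngle t + Real.pi / 3 - axisAngle t) / 2 = Real.pi / 6 by ring, Real.sin_pi_div_six]
  have h1 := axisAngle_pos t
  have h2 := axisAngle_lt ht
  have : 0 < Real.cos ((axisAngle t + Real.pi / 3 + axisAngle t) / 2) :=
    Real.cos_pos_of_mem_Ioo ⟨by linarith, by linarith⟩
  linarith

/-- Indeed `3/2 * axisAngle t = π/2 - arctan t`, whose cotangent is `t`. -/
theorem cos_axisAngle (t : ℝ) : Real.cos (3 / 2 * axisAngle t) =
    t * Real.sin (3 / 2 * axisAngle t) := by
  rw [axisAngle, show 3 / 2 * ((Real.pi - 2 * Real.arctan t) / 3) = Real.pi / 2 - Real.arctan t by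
    ring, Real.cos_pi_div_two_sub, Real.sin_pi_div_two_sub, Real.sin_arctan, Real.cos_arctan]
  ring

theorem sin_three_halves_axisAngle_pos {t : ℝ} (ht : 0 < t) :
    0 < Real.sin (3 / 2 * axisAngle t) :=
  Real.sin_pos_of_pos_of_lt_pi (by linarith [axisAngle_pos t])
    (by linarith [axisAngle_lt ht, Real.pi_pos])

theorem exp_mul_I_eq (θ : ℝ) :
    Complex.exp (θ * Complex.I) = Real.cos θ + Real.sin θ * Complex.I := by
  rw [Complex.exp_mul_I, Complex.ofReal_cos, Complex.ofReal_sin]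

theorem sin_add_pi_div_three (γ : ℝ) : Real.sin (γ + Real.pi / 3) =
    1 / 2 * Real.sin γ + Real.sqrt 3 / 2 * Real.cos γ := by
  rw [Real.sin_add, Real.cos_pi_div_three, Real.sin_pi_div_three]
  ring

/-- Law of sines in the triangle `0`, `1`, `ρ e^{iπ/3}` with `ρ = axisRatio t`: its angles at `0`
and `1` are `π/3` and `axisAngle t`. -/
theorem one_sub_axisRatio_mul_exp {t : ℝ} (ht : 0 < t) :
    1 + Complex.exp ((Real.pi / 3 : ℝ) * Complex.I) * (-axisRatio t : ℝ) =
      ((Real.sqrt 3 / 2 / Real.sin (axisAngle t + Real.pi / 3) : ℝ) : ℂ) *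
        Complex.exp ((-axisAngle t : ℝ) * Complex.I) := by
  have h := (sin_axisAngle_add_pos ht).ne'
  have hS := sin_add_pi_div_three (axisAngle t)
  rw [exp_mul_I_eq, exp_mul_I_eq, Real.cos_neg, Real.sin_neg, Real.cos_pi_div_three,
    Real.sin_pi_div_three, axisRatio]
  generalize Real.sin (axisAngle t + Real.pi / 3) = S at h hS
  apply Complex.ext
  · simp only [Complex.add_re, Complex.one_re, Complex.re_mul_ofReal, Complex.re_ofReal_mul,
      Complex.ofReal_re, Complex.I_re]
    field_simp
    linear_combination 2 * hS
  · simp only [Complex.add_im, Complex.one_im, Complex.im_mul_ofReal, Complex.im_ofReal_mul,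
      Complex.ofReal_im, Complex.I_im]
    field_simp
    ring

theorem one_sub_axisRatio_mul_exp_neg {t : ℝ} (ht : 0 < t) :
    1 + Complex.exp ((-(Real.pi / 3) : ℝ) * Complex.I) * (-axisRatio t : ℝ) =
      ((Real.sqrt 3 / 2 / Real.sin (axisAngle t + Real.pi / 3) : ℝ) : ℂ) *
        Complex.exp ((axisAngle t : ℝ) * Complex.I) := by
  have h := congrArg (starRingEnd ℂ) (one_sub_axisRatio_mul_exp ht)
  simp only [map_add, map_neg, map_one, map_mul, Complex.conj_ofReal, ← Complex.exp_conj, Complex.conj_I,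
    Complex.ofReal_neg, mul_neg, neg_mul, neg_neg] at h ⊢
  exact h

/-- The two bases are conjugate with arguments `∓axisAngle t`, so the quotient of their `3/2` powers
reduces to `-cot (3/2 * axisAngle t)`. -/
theorem sheetSum_div_sheetDiff_axisRatio {t : ℝ} (ht : 0 < t) :
    sheetSum (-axisRatio t : ℝ) / sheetDiff (-axisRatio t : ℝ) = -t := by
  have hp := Real.pi_pos
  have h1 := axisAngle_pos t
  have h2 := axisAngle_lt ht
  have hr : 0 < Real.sqrt 3 / 2 / Real.sin (axisAngle t + Real.pi / 3) :=
    div_pos (by positivity) (sin_axisAngle_add_pos ht)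
  have hs := sin_three_halves_axisAngle_pos ht
  have hr' := Real.rpow_pos_of_pos hr (3 / 2)
  rw [sheetSum, sheetDiff, shiftedPow, shiftedPow, one_sub_axisRatio_mul_exp ht,
    one_sub_axisRatio_mul_exp_neg ht, mul_exp_cpow hr.le (by linarith) (by linarith),
    mul_exp_cpow hr.le (by linarith) (by linarith), mul_neg, exp_mul_I_eq, exp_mul_I_eq,
    Real.cos_neg, Real.sin_neg, cos_axisAngle]
  generalize Real.sin (3 / 2 * axisAngle t) = s at hs
  generalize (Real.sqrt 3 / 2 / Real.sin (axisAngle t + Real.pi / 3)) ^ (3 / 2 : ℝ) = r at hr'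
  have hs' : (s : ℂ) ≠ 0 := by exact_mod_cast hs.ne'
  have hr'' : (r : ℂ) ≠ 0 := by exact_mod_cast hr'.ne'
  have hd : (r * ((t * s : ℝ) + (-s : ℝ) * Complex.I) - r * ((t * s : ℝ) + s * Complex.I) : ℂ) =
      -2 * r * s * Complex.I := by
    push_cast
    ring
  rw [hd, div_eq_iff (by simp [hs', hr''])]
  push_cast
  ring

theorem halfDiscMap_neg {t : ℝ} (ht : 0 < t) :
    halfDiscMap ((-t : ℝ) : ℂ) = ((-(axisRatio t)⁻¹ : ℝ) : ℂ) := by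
  have hp := Real.pi_pos
  have h1 := axisAngle_pos t
  have h2 := axisAngle_lt ht
  have hs := sin_three_halves_axisAngle_pos ht
  have hs' : (Real.sin (3 / 2 * axisAngle t) : ℂ) ≠ 0 := by exact_mod_cast hs.ne'
  have hw : (((-t : ℝ) : ℂ) - Complex.I) / (((-t : ℝ) : ℂ) + Complex.I) =
      Complex.exp ((3 * axisAngle t : ℝ) * Complex.I) := by
    have e1 : Complex.exp ((3 / 2 * axisAngle t : ℝ) * Complex.I) =
        -(Real.sin (3 / 2 * axisAngle t)) * (((-t : ℝ) : ℂ) - Complex.I) := by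
      rw [exp_mul_I_eq, cos_axisAngle]
      push_cast
      ring
    have e2 : Complex.exp ((-(3 / 2 * axisAngle t) : ℝ) * Complex.I) =
        -(Real.sin (3 / 2 * axisAngle t)) * (((-t : ℝ) : ℂ) + Complex.I) := by
      rw [exp_mul_I_eq, Real.cos_neg, Real.sin_neg, cos_axisAngle]
      push_cast
      ring
    rw [← mul_div_mul_left _ _ (neg_ne_zero.2 hs'), ← e1, ← e2, ← Complex.exp_sub]
    congr 1
    push_cast
    ring
  -- Since `0 < 3 * axisAngle t < π`, the principal power simply multiplies the angle by `2/3`.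
  have hu : Complex.exp ((3 * axisAngle t : ℝ) * Complex.I) ^ (2 / 3 : ℂ) =
      Complex.exp (axisAngle t * Complex.I) * Complex.exp (axisAngle t * Complex.I) := by
    rw [Complex.cpow_def_of_ne_zero (Complex.exp_ne_zero _), Complex.log_exp,
      ← Complex.exp_add]
    · congr 1
      push_cast
      ring
    · rw [Complex.im_ofReal_mul,
        Complex.I_im]
      linarith
    · rw [Complex.im_ofReal_mul, Complex.I_im]
      linarith
  have hsin := sin_axisAngle_pos ht
  have hsin' : (Real.sin (axisAngle t) : ℂ) ≠ 0 := by exact_mod_cast hsin.ne'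
  have hE := Complex.exp_ne_zero (axisAngle t * Complex.I)
  have hcs : Complex.exp (axisAngle t * Complex.I) *
      (Real.cos (axisAngle t) - Real.sin (axisAngle t) * Complex.I) = 1 := by
    rw [exp_mul_I_eq]
    have : (Real.sin (axisAngle t) : ℂ) ^ 2 + (Real.cos (axisAngle t) : ℂ) ^ 2 = 1 := by
      exact_mod_cast Real.sin_sq_add_cos_sq (axisAngle t)
    linear_combination this - (Real.sin (axisAngle t) : ℂ) ^ 2 * Complex.I_sq
  have hE' := exp_mul_I_eq (axisAngle t)
  rw [halfDiscMap, hw, hu, axisRatio, inv_div, sin_add_pi_div_three]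
  generalize Complex.exp (axisAngle t * Complex.I) = E at *
  have e1 : E * E - 1 = 2 * Complex.I * Real.sin (axisAngle t) * E := by
    linear_combination E * hE' + hcs
  have e2 : E * E + 1 = 2 * Real.cos (axisAngle t) * E := by
    linear_combination E * hE' - hcs
  have e3 : (1 - E * E) - (Real.sqrt 3 : ℂ) * Complex.I * (1 + E * E) =
      (-(Real.sin (axisAngle t) + Real.sqrt 3 * Real.cos (axisAngle t))) *
        (2 * Complex.I * E) := by
    linear_combination -e1 - (Real.sqrt 3 : ℂ) * Complex.I * e2
  have hI := Complex.I_ne_zero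
  simp only [e1, e3]
  push_cast
  field_simp

theorem norm_halfDiscMap_neg {t : ℝ} (ht : 0 < t) :
    ‖halfDiscMap ((-t : ℝ) : ℂ)‖ = (axisRatio t)⁻¹ := by
  rw [halfDiscMap_neg ht, Complex.norm_real, norm_neg,
    Real.norm_of_nonneg (inv_nonneg.2 (axisRatio_pos ht).le)]

theorem norm_halfDiscMap_of_one_lt {κ : ℝ} (hκ : 1 < κ) :
    ‖halfDiscMap ((-1 / (κ - 1) : ℝ) : ℂ)‖ = (axisRatio (κ - 1)⁻¹)⁻¹ := by
  rw [show -1 / (κ - 1) = -(κ - 1)⁻¹ by ring]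
  exact norm_halfDiscMap_neg (inv_pos.2 (sub_pos.2 hκ))

/-! ### Transfer to the admissible spectrum -/

/-- A polynomial with value `1` at `0` is not small on the half-disc `μ + (L - μ) Ω`. -/
theorem exists_axisRatio_pow_le_norm_eval {p : ℂ[X]} {T : ℕ} (hp : p.natDegree ≤ T)
    (h0 : p.eval 0 = 1) {μ L : ℝ} (hμ : 0 < μ) (hL : μ < L) :
    ∃ l : ℂ, μ ≤ l.re ∧ ‖l‖ ≤ L ∧ axisRatio (L / μ - 1)⁻¹ ^ T ≤ ‖p.eval l‖ := by
  have ht : 0 < (L / μ - 1)⁻¹ := inv_pos.2 (sub_pos.2 ((one_lt_div hμ).2 hL))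
  have hd : (C (μ : ℂ) + C ((L - μ : ℝ) : ℂ) * X).natDegree ≤ 1 :=
    natDegree_add_le_of_degree_le (by simp) ((natDegree_C_mul_le _ _).trans natDegree_X_le)
  have hq : (p.comp (C (μ : ℂ) + C ((L - μ : ℝ) : ℂ) * X)).natDegree ≤ T :=
    natDegree_comp_le.trans ((Nat.mul_le_mul hp hd).trans (mul_one T).le)
  have hρ := axisRatio_pos ht
  obtain ⟨l, hl1, hl2, hl⟩ := exists_mem_halfDisc_le_norm_eval _ hq
    (ζ := (-axisRatio (L / μ - 1)⁻¹ : ℝ)) (by exact_mod_cast (neg_lt_zero.2 hρ).ne)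
    (by rw [Complex.norm_real, norm_neg, Real.norm_of_nonneg hρ.le]; exact axisRatio_lt_one ht)
  rw [sheetSum_div_sheetDiff_axisRatio ht, Complex.norm_real, norm_neg, Real.norm_of_nonneg hρ.le,
    eval_comp, eval_comp] at hl
  simp only [eval_add, eval_C, eval_mul, eval_X] at hl
  -- The affine map carries `-1/(κ-1)` to `0`, where the normalisation `p(0) = 1` applies.
  have hz : (μ : ℂ) + ((L - μ : ℝ) : ℂ) * -((L / μ - 1)⁻¹ : ℝ) = 0 := by
    have : μ + (L - μ) * -(L / μ - 1)⁻¹ = 0 := by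
      have : L - μ ≠ 0 := (sub_pos.2 hL).ne'
      rw [show L / μ - 1 = (L - μ) / μ by field_simp]
      field_simp
      ring
    exact_mod_cast this
  rw [hz, h0, norm_one, mul_one] at hl
  refine ⟨μ + (L - μ : ℝ) * l, ?_, ?_, hl⟩
  · rw [Complex.add_re, Complex.ofReal_re, Complex.re_ofReal_mul]
    have := mul_nonneg (sub_pos.2 hL).le hl2
    linarith
  · refine (norm_add_le _ _).trans ?_
    rw [norm_mul, Complex.norm_real, Complex.norm_real, Real.norm_of_nonneg hμ.le,
      Real.norm_of_nonneg (sub_pos.2 hL).le]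
    have := mul_le_mul_of_nonneg_left hl1 (sub_pos.2 hL).le
    linarith

/-! ### Asymptotic rate -/

theorem hasDerivAt_log_axisRatio :
    HasDerivAt (fun t => Real.log (axisRatio t)⁻¹) (4 / (3 * Real.sqrt 3)) 0 := by
  have h0 : axisAngle 0 = Real.pi / 3 := by simp [axisAngle]
  have hγ : HasDerivAt axisAngle (-2 / 3) 0 := by
    have := (((Real.hasDerivAt_arctan 0).const_mul 2).const_sub Real.pi).div_const 3
    refine this.congr_deriv ?_
    norm_num
  have hs1 : Real.sin (axisAngle 0 + Real.pi / 3) = Real.sqrt 3 / 2 := by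
    rw [sin_add_pi_div_three, h0, Real.sin_pi_div_three, Real.cos_pi_div_three]
    ring
  have hc1 : Real.cos (axisAngle 0 + Real.pi / 3) = -(1 / 2) := by
    rw [Real.cos_add, h0, Real.sin_pi_div_three, Real.cos_pi_div_three]
    linear_combination (-1 / 4 : ℝ) * Real.sq_sqrt (show (0 : ℝ) ≤ 3 by norm_num)
  have hs2 : Real.sin (axisAngle 0) = Real.sqrt 3 / 2 := by rw [h0, Real.sin_pi_div_three]
  have hc2 : Real.cos (axisAngle 0) = 1 / 2 := by rw [h0, Real.cos_pi_div_three]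
  have h3 : 0 < Real.sqrt 3 := by positivity
  have hne : axisRatio 0 ≠ 0 := by
    rw [axisRatio, hs1, hs2]
    positivity
  have hr : HasDerivAt axisRatio _ 0 := hγ.sin.div (hγ.add_const (Real.pi / 3)).sin
    (by rw [hs1]; positivity)
  have := (hr.inv hne).log (inv_ne_zero hne)
  refine this.congr_deriv ?_
  rw [Pi.inv_apply, axisRatio, hs1, hs2, hc1, hc2]
  field_simp
  norm_num

theorem tendsto_mul_log_axisRatio :
    Filter.Tendsto (fun κ : ℝ => κ * Real.log (axisRatio (κ - 1)⁻¹)⁻¹) Filter.atTop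
      (𝓝 (4 / (3 * Real.sqrt 3))) := by
  have hsub : Filter.Tendsto (fun κ : ℝ => κ - 1) Filter.atTop Filter.atTop :=
    Filter.tendsto_atTop_add_const_right _ _ Filter.tendsto_id
  have hinv : Filter.Tendsto (fun κ : ℝ => (κ - 1)⁻¹) Filter.atTop (𝓝[≠] 0) :=
    ((tendsto_inv_atTop_nhdsGT_zero).comp hsub).mono_right
      (nhdsWithin_mono _ fun x hx => (ne_of_gt hx))
  have h0 : Real.log (axisRatio 0)⁻¹ = 0 := by
    have h1 : axisAngle 0 = Real.pi / 3 := by simp [axisAngle]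
    have h3 : 0 < Real.sqrt 3 := by positivity
    have : axisRatio 0 = 1 := by
      rw [axisRatio, sin_add_pi_div_three, h1, Real.sin_pi_div_three, Real.cos_pi_div_three]
      field_simp
      norm_num
    simp [this]
  have hd := (hasDerivAt_iff_tendsto_slope_zero.1 hasDerivAt_log_axisRatio).comp hinv
  -- With `t = 1/(κ-1)` one has `κ = (1 + t)/t`, so the quantity is `1 + t` times the difference
  -- quotient of the logarithm at `0`.
  have hm : Filter.Tendsto (fun κ : ℝ => 1 + (κ - 1)⁻¹) Filter.atTop (𝓝 (1 + 0)) :=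
    (hinv.mono_right nhdsWithin_le_nhds).const_add 1
  have := hm.mul hd
  rw [add_zero, one_mul] at this
  refine this.congr' ?_
  filter_upwards [Filter.eventually_gt_atTop 1] with κ hκ
  have : κ - 1 ≠ 0 := (sub_pos.2 hκ).ne'
  simp only [Function.comp, zero_add, h0, sub_zero, smul_eq_mul, inv_inv]
  field_simp
  ring

end MinMax

end

/-! ### Assembly -/

theorem theorem3p1 :
    (∀ (alg : MinMax.NonadaptiveSymmetricAlgorithm) (T : ℕ) (κ μ L : ℝ),
      0 < μ → κ = L / μ → 1 < κ →
      ∃ dx dy : ℕ, 0 < dx ∧ 0 < dy ∧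
        ∀ z₀ : EuclideanSpace ℝ (Fin dx ⊕ Fin dy),
          ∃ P : MinMax.QuadraticProblem dx dy,
            P.IsSCSC μ ∧ P.IsSmooth L ∧ P.sol ≠ z₀ ∧
              ‖alg.iterate μ L P.saddleOperator z₀ T - P.sol‖ / ‖z₀ - P.sol‖ ≥
                ‖MinMax.halfDiscMap ((-1 / (κ - 1) : ℝ) : ℂ)‖ ^ (-(T : ℤ))) ∧
    ∃ ε : ℝ → ℝ, Filter.Tendsto ε Filter.atTop (𝓝 0) ∧
      ∀ (κ : ℝ) (T : ℕ), 1 < κ →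
        ‖MinMax.halfDiscMap ((-1 / (κ - 1) : ℝ) : ℂ)‖ ^ (-(T : ℤ)) =
          Real.exp (-(4 / (3 * Real.sqrt 3) + ε κ) * (T / κ)) := by
  constructor
  · rintro alg T κ μ L hμ rfl hκ
    obtain ⟨l, hre, hnorm, hl⟩ := MinMax.exists_axisRatio_pow_le_norm_eval
      (alg.natDegree_residual_le μ L T) (alg.eval_residual_zero μ L T) hμ ((one_lt_div hμ).1 hκ)
    refine ⟨1, 1, one_pos, one_pos, fun z₀ => ?_⟩
    -- The solution is placed at distance `1` from `z₀`, so the error ratio is exactly `|p(l)|`; `l`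
    -- itself does not depend on `z₀`.
    obtain ⟨s, rfl⟩ : ∃ s, z₀ = MinMax.complexToPair 1 + s :=
      ⟨z₀ - MinMax.complexToPair 1, by abel⟩
    have hsol : (MinMax.rotationProblem l s).sol = s := rfl
    have h1 : ‖MinMax.complexToPair 1‖ = 1 := by rw [MinMax.norm_complexToPair, norm_one]
    refine ⟨MinMax.rotationProblem l s, MinMax.isSCSC_rotationProblem s hre,
      MinMax.isSmooth_rotationProblem s hnorm, ?_, ?_⟩
    · rw [hsol, ne_eq, right_eq_add]
      intro h
      simp [h] at h1
    · rw [hsol, MinMax.iterate_rotationProblem, add_sub_cancel_right, add_sub_cancel_right, h1,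
        mul_one, MinMax.norm_complexToPair, div_one, MinMax.norm_halfDiscMap_of_one_lt hκ,
        zpow_neg, zpow_natCast, inv_pow, inv_inv]
      exact hl
  -- Solving the required identity for `ε` makes it exact for every `T`; only the limit needs proof.
  · refine ⟨fun κ => κ * Real.log (MinMax.axisRatio (κ - 1)⁻¹)⁻¹ - 4 / (3 * Real.sqrt 3),
      ?_, fun κ T hκ => ?_⟩
    · simpa using MinMax.tendsto_mul_log_axisRatio.sub_const (4 / (3 * Real.sqrt 3))
    · have hρ := MinMax.axisRatio_pos (inv_pos.2 (sub_pos.2 hκ))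
      have hκ0 : κ ≠ 0 := (one_pos.trans hκ).ne'
      rw [MinMax.norm_halfDiscMap_of_one_lt hκ, add_sub_cancel, Real.log_inv,
        show -(κ * -Real.log (MinMax.axisRatio (κ - 1)⁻¹)) * (T / κ) =
          T * Real.log (MinMax.axisRatio (κ - 1)⁻¹) by field_simp, Real.exp_nat_mul,
        Real.exp_log hρ, zpow_neg, zpow_natCast, inv_pow, inv_inv]
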